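/- **Setting.** Fix a set $\Omega_1'$ of unary and a set $\Omega_2'$ of binary operation symbols, with a map $*\mapsto *^\circ$ on $\Omega_2'$; an $\Omega$-algebra is a set with operations $0,-,+$ and operations for all symbols in $\Omega_1'\cup\Omega_2'$. A *category of interest* $\mathbb C$ is the category of all $\Omega$-algebras satisfying a set $\mathbb E$ of identities such that * $\mathbb E$ contains the group laws for $(0,-,+)$ (not necessarily commutative) and the identities $x*^\circ y=y*x$, $x*(y+z)=x*y+x*z$, $\omega(x+y)=\omega(x)+\omega(y)$, $\omega(x)*y=\omega(x*y)$ for $*\in\Omega_2'$, $\omega\in\Omega_1'$; * (Axiom 1) $x_1+(x_2*x_3)=(x_2*x_3)+x_1$ holds in all objects, for $*\in\Omega_2'$; * (Axiom 2) for each ordered pair $(*,\bar*)\in\Omega_2'\times\Omega_2'$ there is a word $W(x_1,x_2;x_3;*,\bar*)$ in expressions of the eight types $x_1(x_2x_3)$, $x_1(x_3x_2)$, $(x_2x_3)x_1$, $(x_3x_2)x_1$, $x_2(x_1x_3)$, $x_2(x_3x_1)$, $(x_1x_3)x_2$, $(x_3x_1)x_2$ (each juxtaposition being some operation of $\Omega_2'$)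 such that $(x_1*x_2)\,\bar*\,x_3=W(x_1,x_2;x_3;*,\bar*)$ holds in all objects. Fix a choice of these words. A *set of actions* of an algebra $B$ on an algebra $A$ consists of maps $B\times A\to A$, $(b,a)\mapsto b\cdot a$ and $(b,a)\mapsto b*a$ for each $*\in\Omega_2'$; put $a*b:=b*^\circ a$. For $A,B\in\mathbb C$ it is an *action in $\mathbb C$* (a set of derived actions) if there is a split extension $0\to A\xrightarrow{i}E\xrightarrow{p}B\to0$ in $\mathbb C$ with splitting $s$ such that $i(b\cdot a)=s(b)+i(a)-s(b)$ and $i(b*a)=s(b)*i(a)$. The semidirect product $B\ltimes A$ is the algebra on $B\times A$ with zero $(0,0)$ and $$(b',a')+(b,a)=(b'+b,\;a'+b'\cdot a),\qquad (b',a')*(b,a)=(b'*b,\;a'*a+a'*b+b'*a),$$ $$-(b,a)=(-b,(-b)\cdot(-a)),\qquad \omega(b,a)=(\omega(b),\omega(a)).$$ A *crossed module* in $\mathbb C$ is a morphism $\partial:A\to X$ in $\mathbb C$ together with an action of $X$ on $A$ in $\mathbb C$ such that $\partial(r\cdot a)=r+\partial(a)-r$, $\partial(a)\cdot a'=a+a'-a$,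 $\partial(a)*a'=a*a'$, $\partial(r*a)=r*\partial(a)$ and $\partial(a*r)=\partial(a)*r$ for all $r\in X$, $a,a'\in A$, $*\in\Omega_2'$. It is an *actor* of $A$ if for every $B\in\mathbb C$ and every action of $B$ on $A$ in $\mathbb C$ there is a unique morphism $\varphi:B\to X$ with $b\cdot a=\varphi(b)\cdot a$ and $b*a=\varphi(b)*a$ for all $b\in B$, $a\in A$, $*\in\Omega_2'$. *The algebra $\mathfrak B(A)$*, for $A\in\mathbb C$. For each $B\in\mathbb C$ acting on $A$ in $\mathbb C$ and each $b\in B$, let $\mathbf b$ be the family of all the maps $a\mapsto w(b)\cdot a$ and $a\mapsto w(b)*a$ $(*\in\Omega_2')$, where $w=\omega_1\cdots\omega_n$ runs through all finite compositions $(n\ge0)$ of operations of $\Omega_1'$. On families $f=(w(f)\cdot{},\,w(f)*{})_w$ of self-maps of $A$ with all $w(f)\cdot{}$ bijective, where $\omega_1\cdots\omega_n(f)$ denotes the member with index $\omega_1\cdots\omega_n$, define operations by * $w(0)\cdot a=a$ and $w(0)*a=0$; $w(-f)\cdot{}$ is the inverse of $w(f)\cdot{}$, and $w(-f)*a=-(w(f)*a)$;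 * $w(f+g)\cdot a=w(f)\cdot(w(g)\cdot a)$ and $w(f+g)*a=w(f)*a+w(g)*a$; * the member of $\omega(f)$ with index $w$ is the member of $f$ with index $w\omega$; * $w(f*g)\cdot a=a$ and $w(f*g)\,\bar*\,a=W(w(f),g;a;*,\bar*)$. Then $\mathfrak B(A)$ is the closure of the set of all $\mathbf b$ under these operations. It has the set of actions on $A$ given by the members with $n=0$. Let $d:A\to\mathfrak B(A)$ be the map sending $a$ to the family $\mathbf a$ attached to $a$ for the conjugation action of $A$ on itself; so $d(a)\cdot a'=a+a'-a$ and $d(a)*a'=a*a'$. **Theorem.** Let $\mathbb C$ be a category of interest and $A$ an object of $\mathbb C$. Then $A$ has an actor in $\mathbb C$ if and only if the semidirect product $\mathfrak B(A)\ltimes A$ is an object of $\mathbb C$. In that case $\mathrm{Actor}(A)=\mathfrak B(A)$: the map $d:A\to\mathfrak B(A)$, with the above set of actions of $\mathfrak B(A)$ on $A$, is an actor of $A$, and for every actor $\partial:A\to X$ of $A$ there is an isomorphism $e:X\to\mathfrak B(A)$ with $e\partial=d$, $e(x)\cdot a=x\cdot a$ and $e(x)*a=x*a$ for all $x\in X$,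 $a\in A$, $*\in\Omega_2'$. -/

import Mathlib

universe u

namespace CatInterest

/-- A signature for groups with operations: `Unary` is the set of unary operations other than `-`,
`Binary` the set of binary operations other than `+`, and `opp` sends the symbol of an operation
`*` to the symbol of the opposite operation (`x opp(*) y = y * x`).
The group operations `0`, `-`, `+` are always present and `0` is the only constant. -/
structure Signature where
  Unary : Type u
  Binary : Type u
  opp : Binary → Binary

/-- A universal algebra of the given signature (no identities are imposed). -/
structure OpAlg (S : Signature.{u}) where
  carrier : Type u
  zero : carrier
  neg : carrier → carrier
  add : carrier → carrier → carrier
  un : S.Unary → carrier → carrier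
  bin : S.Binary → carrier → carrier → carrier

variable {S : Signature.{u}}

instance : CoeSort (OpAlg S) (Type u) := ⟨OpAlg.carrier⟩
instance (A : OpAlg S) : Zero A := ⟨A.zero⟩
instance (A : OpAlg S) : Neg A := ⟨A.neg⟩
instance (A : OpAlg S) : Add A := ⟨A.add⟩

/-- Words (terms) in the operations of the signature, with variables from `X`. -/
inductive Word (S : Signature.{u}) (X : Type u) : Type u
  | var : X → Word S X
  | zero : Word S X
  | neg : Word S X → Word S X
  | add : Word S X → Word S X → Word S X
  | un : S.Unary → Word S X → Word S X
  | bin : S.Binary → Word S X → Word S X → Word S X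

/-- The value of a word in an algebra. -/
def Word.eval {X : Type u} (A : OpAlg S) (v : X → A) : Word S X → A
  | .var x => v x
  | .zero => 0
  | .neg t => - t.eval A v
  | .add t t' => t.eval A v + t'.eval A v
  | .un w t => A.un w (t.eval A v)
  | .bin s t t' => A.bin s (t.eval A v) (t'.eval A v)

/-- Words in countably many variables. -/
abbrev Term (S : Signature.{u}) : Type u := Word S (ULift.{u} ℕ)

/-- The `n`-th variable. -/
def Term.v (n : ℕ) : Term S := Word.var ⟨n⟩

/-- An identity `l = r`, as the pair `(l, r)`. -/
abbrev Identity (S : Signature.{u}) : Type u := Term S × Term S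

/-- The identities hold in `A`. -/
def OpAlg.Models (A : OpAlg S) (E : Set (Identity S)) : Prop :=
  ∀ e ∈ E, ∀ v : ULift.{u} ℕ → A, e.1.eval A v = e.2.eval A v

open Term in
/-- The basic identities of groups with operations: the group laws, `x *° y = y * x`,
`x * (y + z) = x * y + x * z`, `ω (x + y) = ω x + ω y` and `(ω x) * y = ω (x * y)`. -/
inductive BasicIdentity : Identity S → Prop
  | add_assoc : BasicIdentity (.add (.add (v 0) (v 1)) (v 2), .add (v 0) (.add (v 1) (v 2)))
  | zero_add : BasicIdentity (.add .zero (v 0), v 0)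
  | add_zero : BasicIdentity (.add (v 0) .zero, v 0)
  | neg_add : BasicIdentity (.add (.neg (v 0)) (v 0), .zero)
  | add_neg : BasicIdentity (.add (v 0) (.neg (v 0)), .zero)
  | opp (s : S.Binary) : BasicIdentity (.bin (S.opp s) (v 0) (v 1), .bin s (v 1) (v 0))
  | bin_add (s : S.Binary) : BasicIdentity
      (.bin s (v 0) (.add (v 1) (v 2)), .add (.bin s (v 0) (v 1)) (.bin s (v 0) (v 2)))
  | un_add (w : S.Unary) : BasicIdentity
      (.un w (.add (v 0) (v 1)), .add (.un w (v 0)) (.un w (v 1)))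
  | un_bin (w : S.Unary) (s : S.Binary) : BasicIdentity
      (.bin s (.un w (v 0)) (v 1), .un w (.bin s (v 0) (v 1)))

/-- The eight kinds of arguments which the words of the second axiom may involve. The first
operation is the outer one, the second is the inner one (the one inside the brackets). -/
inductive TripleArg (S : Signature.{u}) : Type u
  | x1_x2x3 : S.Binary → S.Binary → TripleArg S
  | x1_x3x2 : S.Binary → S.Binary → TripleArg S
  | x2x3_x1 : S.Binary → S.Binary → TripleArg S
  | x3x2_x1 : S.Binary → S.Binary → TripleArg S
  | x2_x1x3 : S.Binary → S.Binary → TripleArg S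
  | x2_x3x1 : S.Binary → S.Binary → TripleArg S
  | x1x3_x2 : S.Binary → S.Binary → TripleArg S
  | x3x1_x2 : S.Binary → S.Binary → TripleArg S

/-- The value of the eight kinds of arguments on three elements of an algebra. -/
def TripleArg.eval (A : OpAlg S) (x1 x2 x3 : A) : TripleArg S → A
  | .x1_x2x3 s t => A.bin s x1 (A.bin t x2 x3)
  | .x1_x3x2 s t => A.bin s x1 (A.bin t x3 x2)
  | .x2x3_x1 s t => A.bin s (A.bin t x2 x3) x1
  | .x3x2_x1 s t => A.bin s (A.bin t x3 x2) x1
  | .x2_x1x3 s t => A.bin s x2 (A.bin t x1 x3)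
  | .x2_x3x1 s t => A.bin s x2 (A.bin t x3 x1)
  | .x1x3_x2 s t => A.bin s (A.bin t x1 x3) x2
  | .x3x1_x2 s t => A.bin s (A.bin t x3 x1) x2

/-- A category of interest: a variety of groups with operations, given by a set of identities
containing the basic ones, which satisfies `x₁ + x₂ * x₃ = x₂ * x₃ + x₁` and, for each ordered
pair of operations `(s, t)`, an identity
`(x₁ s x₂) t x₃ = W (x₁ (x₂ x₃), x₁ (x₃ x₂), (x₂ x₃) x₁, …, (x₃ x₁) x₂)`.
A choice of the words `W` is part of the structure, since the algebra `𝔅(A)` is built from it. -/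
structure CategoryOfInterest (S : Signature.{u}) where
  identities : Set (Identity S)
  basic : ∀ e, BasicIdentity e → e ∈ identities
  axiom1 : ∀ A : OpAlg S, A.Models identities → ∀ (s : S.Binary) (x1 x2 x3 : A),
    x1 + A.bin s x2 x3 = A.bin s x2 x3 + x1
  word : S.Binary → S.Binary → Word S (TripleArg S)
  axiom2 : ∀ A : OpAlg S, A.Models identities → ∀ (s t : S.Binary) (x1 x2 x3 : A),
    A.bin t (A.bin s x1 x2) x3 = (word s t).eval A (TripleArg.eval A x1 x2 x3)

/-- `A` is an object of the category of interest. -/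
def CategoryOfInterest.Obj (C : CategoryOfInterest S) (A : OpAlg S) : Prop :=
  A.Models C.identities

/-- Homomorphisms of algebras, i.e. the morphisms of the category when source and target are
objects of it. -/
structure IsHom {A B : OpAlg S} (f : A → B) : Prop where
  map_zero : f 0 = 0
  map_neg : ∀ x, f (-x) = -f x
  map_add : ∀ x y, f (x + y) = f x + f y
  map_un : ∀ w x, f (A.un w x) = B.un w (f x)
  map_bin : ∀ s x y, f (A.bin s x y) = B.bin s (f x) (f y)

/-- A set of actions of `B` on `A`: one map `B × A → A` for `+` (written `b · a`), and one for each
further binary operation (written `b * a`). One writes `a * b` for `b *° a`. -/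
structure ActionSet (B A : OpAlg S) where
  dot : B → A → A
  star : S.Binary → B → A → A

/-- A split extension `0 → A → E → B → 0` of `B` by `A` in the category, with
splitting `σ : B → E`. -/
structure CategoryOfInterest.IsSplitExtension (C : CategoryOfInterest S) {A B E : OpAlg S}
    (i : A → E) (p : E → B) (σ : B → E) : Prop where
  obj_left : C.Obj A
  obj_mid : C.Obj E
  obj_right : C.Obj B
  hom_i : IsHom i
  hom_p : IsHom p
  hom_σ : IsHom σ
  surjective : Function.Surjective p
  injective : Function.Injective i
  kernel : ∀ e, p e = 0 ↔ ∃ a, i a = e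
  split : ∀ b, p (σ b) = b

/-- A set of actions is (a set of) derived actions, or an action in `C`, if it comes from a split
extension in `C` by `b · a = σ(b) + a - σ(b)` and `b * a = σ(b) * a`. -/
def CategoryOfInterest.IsDerived (C : CategoryOfInterest S) {B A : OpAlg S}
    (act : ActionSet B A) : Prop :=
  ∃ (E : OpAlg S) (i : A → E) (p : E → B) (σ : B → E), C.IsSplitExtension i p σ ∧
    (∀ b a, i (act.dot b a) = σ b + i a + -σ b) ∧
    (∀ s b a, i (act.star s b a) = E.bin s (σ b) (i a))

/-- The semidirect product `B ⋉ A`: the universal algebra on `B × A` with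
`(b', a') + (b, a) = (b' + b, a' + b' · a)` and
`(b', a') * (b, a) = (b' * b, a' * a + a' * b + b' * a)`. -/
def semidirect {B A : OpAlg S} (act : ActionSet B A) : OpAlg S where
  carrier := B × A
  zero := (0, 0)
  neg x := (-x.1, act.dot (-x.1) (-x.2))
  add x y := (x.1 + y.1, x.2 + act.dot x.1 y.2)
  un w x := (B.un w x.1, A.un w x.2)
  bin s x y := (B.bin s x.1 y.1,
    A.bin s x.2 y.2 + act.star (S.opp s) y.1 x.2 + act.star s x.1 y.2)

/-- Crossed modules `∂ : A → X` in `C`, with respect to an action of `X` on `A`. -/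
structure CategoryOfInterest.IsCrossedModule (C : CategoryOfInterest S) {X A : OpAlg S}
    (act : ActionSet X A) (del : A → X) : Prop where
  obj_source : C.Obj A
  obj_target : C.Obj X
  derived : C.IsDerived act
  hom : IsHom del
  del_dot : ∀ r a, del (act.dot r a) = r + del a + -r
  dot_del : ∀ a a', act.dot (del a) a' = a + a' + -a
  star_del : ∀ s a a', act.star s (del a) a' = A.bin s a a'
  del_star_left : ∀ s r a, del (act.star s r a) = X.bin s r (del a)
  del_star_right : ∀ s a r, del (act.star (S.opp s) r a) = X.bin s (del a) r

/-- `∂ : A → X`, with an action of `X` on `A`, is an actor of `A`: a crossed module such that every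
action of an object `B` on `A` is induced by a unique morphism `B → X`. -/
structure CategoryOfInterest.IsActor (C : CategoryOfInterest S) {X A : OpAlg S}
    (act : ActionSet X A) (del : A → X) : Prop where
  crossed : C.IsCrossedModule act del
  universal : ∀ (B : OpAlg S) (actB : ActionSet B A), C.Obj B → C.IsDerived actB →
    ∃! φ : B → X, IsHom φ ∧ (∀ b a, actB.dot b a = act.dot (φ b) a) ∧
      (∀ s b a, actB.star s b a = act.star s (φ b) a)

/-- `A` has an actor in `C`. -/
def CategoryOfInterest.HasActor (C : CategoryOfInterest S) (A : OpAlg S) : Prop :=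
  ∃ (X : OpAlg S) (act : ActionSet X A) (del : A → X), C.IsActor act del

section Basic

variable {C : CategoryOfInterest S} {A : OpAlg S}

theorem Obj.add_assoc (h : C.Obj A) (x y z : A) : x + y + z = x + (y + z) :=
  h _ (C.basic _ .add_assoc) (fun n => if n.down = 0 then x else if n.down = 1 then y else z)

theorem Obj.zero_add (h : C.Obj A) (x : A) : 0 + x = x :=
  h _ (C.basic _ .zero_add) (fun _ => x)

theorem Obj.add_zero (h : C.Obj A) (x : A) : x + 0 = x :=
  h _ (C.basic _ .add_zero) (fun _ => x)

theorem Obj.neg_add (h : C.Obj A) (x : A) : -x + x = 0 :=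
  h _ (C.basic _ .neg_add) (fun _ => x)

theorem Obj.add_neg (h : C.Obj A) (x : A) : x + -x = 0 :=
  h _ (C.basic _ .add_neg) (fun _ => x)

theorem Obj.bin_add (h : C.Obj A) (s : S.Binary) (x y z : A) :
    A.bin s x (y + z) = A.bin s x y + A.bin s x z :=
  h _ (C.basic _ (.bin_add s)) (fun n => if n.down = 0 then x else if n.down = 1 then y else z)

/-- An object of `C` with its additive group structure. -/
abbrev Obj.addGroup (h : C.Obj A) : AddGroup A :=
  { (inferInstance : Zero A), (inferInstance : Add A), (inferInstance : Neg A) with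
    add_assoc := Obj.add_assoc h
    zero_add := Obj.zero_add h
    add_zero := Obj.add_zero h
    nsmul := nsmulRec
    zsmul := zsmulRec
    neg_add_cancel := Obj.neg_add h }

theorem Obj.bin_zero (h : C.Obj A) (s : S.Binary) (x : A) : A.bin s x 0 = 0 := by
  let _ := Obj.addGroup h
  have := Obj.bin_add h s x 0 0
  rw [Obj.zero_add h] at this
  exact left_eq_add.mp this

theorem IsDerived.neg_dot_dot {B : OpAlg S} {act : ActionSet B A} (h : C.IsDerived act)
    (b : B) (a : A) : act.dot (-b) (act.dot b a) = a := by
  obtain ⟨E, i, p, σ, hE, hd, -⟩ := h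
  let _ := Obj.addGroup hE.obj_mid
  apply hE.injective
  rw [hd, hd, hE.hom_σ.map_neg]
  simp [_root_.add_assoc]

theorem IsDerived.dot_neg_dot {B : OpAlg S} {act : ActionSet B A} (h : C.IsDerived act)
    (b : B) (a : A) : act.dot b (act.dot (-b) a) = a := by
  obtain ⟨E, i, p, σ, hE, hd, -⟩ := h
  let _ := Obj.addGroup hE.obj_mid
  apply hE.injective
  rw [hd, hd, hE.hom_σ.map_neg]
  simp [_root_.add_assoc]

end Basic

/-- `unWord [ω₁, …, ωₙ] b = ω₁ (⋯ (ωₙ b))`. -/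
def OpAlg.unWord (B : OpAlg S) (w : List S.Unary) (b : B) : B := w.foldr B.un b

/-- A function which assigns a self-map of `A` to each binary operation: `dot` is the value at `+`
(a bijection), and `star s` is the value at the operation `s`. -/
@[ext] structure Operator (A : OpAlg S) where
  dot : Equiv.Perm A
  star : S.Binary → A → A

/-- The values on `a` of the eight kinds of arguments of the words of the second axiom, where `x₁`
and `x₂` are replaced by operators and products with them by their actions (the right action
`a * b` is the action `b *° a`). -/
def TripleArg.evalOp {A : OpAlg S} (f g : Operator A) (a : A) : TripleArg S → A
  | .x1_x2x3 s t => f.star s (g.star t a)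
  | .x1_x3x2 s t => f.star s (g.star (S.opp t) a)
  | .x2x3_x1 s t => f.star (S.opp s) (g.star t a)
  | .x3x2_x1 s t => f.star (S.opp s) (g.star (S.opp t) a)
  | .x2_x1x3 s t => g.star s (f.star t a)
  | .x2_x3x1 s t => g.star s (f.star (S.opp t) a)
  | .x1x3_x2 s t => g.star (S.opp s) (f.star t a)
  | .x3x1_x2 s t => g.star (S.opp s) (f.star (S.opp t) a)

/-- The operator `0`: `0 · a = a`, `0 * a = 0`. -/
def Operator.zero (A : OpAlg S) : Operator A := ⟨1, fun _ _ => 0⟩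

/-- The operator `-f`: `(-f) · ` is inverse to `f · `, and `(-f) * a = -(f * a)`. -/
def Operator.neg {A : OpAlg S} (f : Operator A) : Operator A :=
  ⟨f.dot⁻¹, fun s a => -f.star s a⟩

/-- The operator `f + g`: `(f + g) · a = f · (g · a)`, `(f + g) * a = f * a + g * a`. -/
def Operator.add {A : OpAlg S} (f g : Operator A) : Operator A :=
  ⟨f.dot * g.dot, fun s a => f.star s a + g.star s a⟩

/-- The operator `f * g`, for an operation `* = s`: `(f * g) · a = a`, and `(f * g) t a` is
given by the word of the second axiom for the pair `(s, t)`, evaluated at `f, g, a`. -/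
def Operator.bin (C : CategoryOfInterest S) {A : OpAlg S} (s : S.Binary) (f g : Operator A) :
    Operator A :=
  ⟨1, fun t a => (C.word s t).eval A (TripleArg.evalOp f g a)⟩

/-- An element `b` of `𝔅(A)` is determined by the actions on `A` of all the elements `ω₁ ⋯ ωₙ b`;
so it is represented by the family, over all lists `[ω₁, …, ωₙ]` of unary operations, of the
operators which give these actions. The empty list corresponds to `b` itself. -/
abbrev OperatorFamily (A : OpAlg S) : Type u := List S.Unary → Operator A

/-- The universal algebra of all operator families:
`w (-f) = -(w f)`, `w (f + g) = w f + w g`, `w (ω f) = (w ω) f` and `w (f * g) = (w f) * g`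
for each list `w` of unary operations. -/
def operatorFamilies (C : CategoryOfInterest S) (A : OpAlg S) : OpAlg S where
  carrier := OperatorFamily A
  zero := fun _ => Operator.zero A
  neg f := fun w => (f w).neg
  add f g := fun w => (f w).add (g w)
  un ω f := fun w => f (w ++ [ω])
  bin s f g := fun w => Operator.bin C s (f w) (g [])

/-- The family attached to an element `b` of an object `B` which acts on `A`. -/
def bold {C : CategoryOfInterest S} {B A : OpAlg S} {act : ActionSet B A} (h : C.IsDerived act)
    (b : B) : operatorFamilies C A := fun w =>
  { dot :=
      { toFun := act.dot (B.unWord w b)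
        invFun := act.dot (-B.unWord w b)
        left_inv := IsDerived.neg_dot_dot h _
        right_inv := IsDerived.dot_neg_dot h _ }
    star := fun s => act.star s (B.unWord w b) }

/-- The closure, under all operations, of the set of the families attached to the elements of
all objects of `C` which act on `A`. -/
inductive InB (C : CategoryOfInterest S) (A : OpAlg S) : operatorFamilies C A → Prop
  | bold {B : OpAlg S} {act : ActionSet B A} (h : C.IsDerived act) (b : B) : InB C A (bold h b)
  | zero : InB C A 0
  | neg {f} : InB C A f → InB C A (-f)
  | add {f g} : InB C A f → InB C A g → InB C A (f + g)
  | un (ω) {f} : InB C A f → InB C A ((operatorFamilies C A).un ω f)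
  | bin (s) {f g} : InB C A f → InB C A g → InB C A ((operatorFamilies C A).bin s f g)

/-- The algebra `𝔅(A)`. -/
def frakB (C : CategoryOfInterest S) (A : OpAlg S) : OpAlg S where
  carrier := {f : operatorFamilies C A // InB C A f}
  zero := ⟨0, .zero⟩
  neg f := ⟨-f.1, .neg f.2⟩
  add f g := ⟨f.1 + g.1, .add f.2 g.2⟩
  un ω f := ⟨(operatorFamilies C A).un ω f.1, .un ω f.2⟩
  bin s f g := ⟨(operatorFamilies C A).bin s f.1 g.1, .bin s f.2 g.2⟩

/-- The set of actions of `𝔅(A)` on `A`. -/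
def frakBAct (C : CategoryOfInterest S) (A : OpAlg S) : ActionSet (frakB C A) A where
  dot f a := (f.1 []).dot a
  star s f a := (f.1 []).star s a

/-- The conjugation action of `A` on itself: `a · a' = a + a' - a`, `a * a' = a * a'`. -/
def conj (A : OpAlg S) : ActionSet A A where
  dot a a' := a + a' + -a
  star s a a' := A.bin s a a'

/-- The direct product `A × A`. -/
def square (A : OpAlg S) : OpAlg S where
  carrier := A × A
  zero := (0, 0)
  neg x := (-x.1, -x.2)
  add x y := (x.1 + y.1, x.2 + y.2)
  un w x := (A.un w x.1, A.un w x.2)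
  bin s x y := (A.bin s x.1 y.1, A.bin s x.2 y.2)

theorem eval_square {X : Type u} (A : OpAlg S) (v : X → square A) (t : Word S X) :
    t.eval (square A) v = (t.eval A (fun x => (v x).1), t.eval A (fun x => (v x).2)) := by
  induction t with
  | var x => rfl
  | zero => rfl
  | neg t ih => simp only [Word.eval, ih]; rfl
  | add t t' ih ih' => simp only [Word.eval, ih, ih']; rfl
  | un w t ih => simp only [Word.eval, ih]; rfl
  | bin s t t' ih ih' => simp only [Word.eval, ih, ih']; rfl

theorem obj_square {C : CategoryOfInterest S} {A : OpAlg S} (hA : C.Obj A) : C.Obj (square A) := by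
  intro e he v
  rw [eval_square, eval_square, hA e he, hA e he]

theorem map_un_zero {C : CategoryOfInterest S} {A : OpAlg S} (hA : C.Obj A) (w : S.Unary) :
    A.un w 0 = 0 := by
  let _ := Obj.addGroup hA
  have h : A.un w (0 + 0) = A.un w 0 + A.un w 0 :=
    hA _ (C.basic _ (.un_add w)) (fun _ => 0)
  rw [Obj.zero_add hA] at h
  exact left_eq_add.mp h

theorem isDerived_conj {C : CategoryOfInterest S} {A : OpAlg S} (hA : C.Obj A) :
    C.IsDerived (conj A) := by
  have hn : -(0 : A) = 0 := by
    have := Obj.add_neg hA (0 : A)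
    rwa [Obj.zero_add hA] at this
  refine ⟨square A, fun a => ((0, a) : A × A), fun x => x.1, fun a => ((a, a) : A × A),
    ⟨hA, obj_square hA, hA, ⟨rfl, ?_, ?_, ?_, ?_⟩, ⟨rfl, fun _ => rfl, fun _ _ => rfl,
      fun _ _ => rfl, fun _ _ _ => rfl⟩, ⟨rfl, fun _ => rfl, fun _ _ => rfl,
      fun _ _ => rfl, fun _ _ _ => rfl⟩, fun a => ⟨(a, a), rfl⟩, ?_, ?_, fun _ => rfl⟩, ?_, ?_⟩
  · exact fun x => Prod.ext hn.symm rfl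
  · exact fun x y => Prod.ext (Obj.zero_add hA 0).symm rfl
  · exact fun w x => Prod.ext (map_un_zero hA w).symm rfl
  · exact fun s x y => Prod.ext (Obj.bin_zero hA s 0).symm rfl
  · exact fun x y h => congrArg Prod.snd h
  · intro e
    constructor
    · intro h
      exact ⟨e.2, Prod.ext h.symm rfl⟩
    · rintro ⟨a, rfl⟩
      rfl
  · intro b a
    refine Prod.ext ?_ rfl
    change (0 : A) = b + 0 + -b
    rw [Obj.add_zero hA, Obj.add_neg hA]
  · intro s b a
    exact Prod.ext (Obj.bin_zero hA s b).symm rfl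

/-- The map `d : A → 𝔅(A)`, with `d(a) · a' = a + a' - a` and `d(a) * a' = a * a'`. -/
def dMap {C : CategoryOfInterest S} {A : OpAlg S} (hA : C.Obj A) (a : A) : frakB C A :=
  ⟨bold (isDerived_conj hA) a, .bold _ a⟩

end CatInterest

/-!
For every derived action of `B` on `A`, the map `b ↦ 𝐛` is a homomorphism from `B` to the algebra
of operator families, since the operations of the latter are the formulas which hold in a split
extension that yields the action (`isHom_bold`). It is the only homomorphism to `𝔅(A)` which
induces the action (`IsHom.eq_toFrakB`), because the family of an element `b` consists of the
actions of the elements `ω₁ ⋯ ωₙ b`.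

If `X` is an actor of `A`, then `x ↦ 𝐱` is an isomorphism from `X` to `𝔅(A)`. It is surjective, as
its image is closed under the operations and contains all families `𝐛`. It is injective, as the two
projections of its kernel pair, an object acting on `A`, induce the same action. Then `𝔅(A) ⋉ A` is
isomorphic to `X ⋉ A`, which is an object since it embeds in a split extension.

Conversely, if `𝔅(A) ⋉ A` is an object, it is a split extension, so that the action of `𝔅(A)` on
`A` is derived, and the universal property of an actor is the one above. The equations of a crossed
module follow from the action of a split extension on its kernel: it gives a homomorphism from the
extension to `𝔅(A)` which restricts to `d` on `A` and to the identity on `𝔅(A)`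
(`isCrossedModule_dMap`).
-/

namespace CatInterest

variable {S : Signature.{u}} {C : CategoryOfInterest S}

/-! ### Homomorphisms and identities -/

theorem IsHom.eval {A B : OpAlg S} {f : A → B} (hf : IsHom f) {X : Type u} (v : X → A)
    (t : Word S X) : f (t.eval A v) = t.eval B (fun x => f (v x)) := by
  induction t with
  | var x => rfl
  | zero => exact hf.map_zero
  | neg t ih => simp only [Word.eval, hf.map_neg, ih]
  | add t t' ih ih' => simp only [Word.eval, hf.map_add, ih, ih']
  | un w t ih => simp only [Word.eval, hf.map_un, ih]
  | bin s t t' ih ih' => simp only [Word.eval, hf.map_bin, ih, ih']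

theorem IsHom.comp {A B D : OpAlg S} {g : B → D} {f : A → B} (hg : IsHom g) (hf : IsHom f) :
    IsHom (fun x => g (f x)) where
  map_zero := by rw [hf.map_zero, hg.map_zero]
  map_neg x := by rw [hf.map_neg, hg.map_neg]
  map_add x y := by rw [hf.map_add, hg.map_add]
  map_un w x := by rw [hf.map_un, hg.map_un]
  map_bin s x y := by rw [hf.map_bin, hg.map_bin]

theorem IsHom.unWord {A B : OpAlg S} {f : A → B} (hf : IsHom f) (w : List S.Unary) (x : A) :
    f (A.unWord w x) = B.unWord w (f x) := by
  induction w with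
  | nil => rfl
  | cons ω w ih => exact (hf.map_un ω _).trans (congrArg (B.un ω) ih)

theorem obj_of_injective {A B : OpAlg S} {f : A → B} (hf : IsHom f)
    (hinj : Function.Injective f) (hB : C.Obj B) : C.Obj A := by
  intro e he v
  apply hinj
  rw [hf.eval, hf.eval, hB e he]

theorem obj_of_surjective {A B : OpAlg S} {f : A → B} (hf : IsHom f)
    (hsurj : Function.Surjective f) (hA : C.Obj A) : C.Obj B := by
  intro e he v
  choose g hg using hsurj
  have hv : v = fun n => f (g (v n)) := funext fun n => (hg _).symm
  rw [hv, ← hf.eval, ← hf.eval, hA e he]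

/-! ### Consequences of the basic identities -/

section Obj

variable {A : OpAlg S}

theorem Obj.opp_bin (h : C.Obj A) (s : S.Binary) (x y : A) :
    A.bin (S.opp s) x y = A.bin s y x :=
  h _ (C.basic _ (.opp s)) (fun n => if n.down = 0 then x else y)

theorem Obj.un_add (h : C.Obj A) (w : S.Unary) (x y : A) :
    A.un w (x + y) = A.un w x + A.un w y :=
  h _ (C.basic _ (.un_add w)) (fun n => if n.down = 0 then x else y)

theorem Obj.un_bin (h : C.Obj A) (w : S.Unary) (s : S.Binary) (x y : A) :
    A.un w (A.bin s x y) = A.bin s (A.un w x) y :=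
  (h _ (C.basic _ (.un_bin w s)) (fun n => if n.down = 0 then x else y)).symm

theorem Obj.add_bin (h : C.Obj A) (s : S.Binary) (x y z : A) :
    A.bin s (x + y) z = A.bin s x z + A.bin s y z := by
  rw [← Obj.opp_bin h, Obj.bin_add h, Obj.opp_bin h, Obj.opp_bin h]

theorem Obj.zero_bin (h : C.Obj A) (s : S.Binary) (x : A) : A.bin s 0 x = 0 := by
  rw [← Obj.opp_bin h, Obj.bin_zero h]

theorem Obj.neg_zero (h : C.Obj A) : -(0 : A) = 0 := by
  rw [← Obj.zero_add h (-0), Obj.add_neg h]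

theorem Obj.eq_neg_of_add_eq_zero (h : C.Obj A) {x y : A} (hxy : x + y = 0) : x = -y := by
  let _ := Obj.addGroup h
  exact eq_neg_of_add_eq_zero_left hxy

theorem Obj.neg_bin (h : C.Obj A) (s : S.Binary) (x y : A) :
    A.bin s (-x) y = -A.bin s x y := by
  apply Obj.eq_neg_of_add_eq_zero h
  rw [← Obj.add_bin h, Obj.neg_add h, Obj.zero_bin h]

theorem Obj.un_neg (h : C.Obj A) (w : S.Unary) (x : A) : A.un w (-x) = -A.un w x := by
  apply Obj.eq_neg_of_add_eq_zero h
  rw [← Obj.un_add h, Obj.neg_add h, map_un_zero h]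

theorem Obj.unWord_zero (h : C.Obj A) (w : List S.Unary) : A.unWord w 0 = 0 := by
  induction w with
  | nil => rfl
  | cons ω w ih => exact (congrArg (A.un ω) ih).trans (map_un_zero h ω)

theorem Obj.unWord_neg (h : C.Obj A) (w : List S.Unary) (x : A) :
    A.unWord w (-x) = -A.unWord w x := by
  induction w with
  | nil => rfl
  | cons ω w ih => exact (congrArg (A.un ω) ih).trans (Obj.un_neg h ω _)

theorem Obj.unWord_add (h : C.Obj A) (w : List S.Unary) (x y : A) :
    A.unWord w (x + y) = A.unWord w x + A.unWord w y := by
  induction w with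
  | nil => rfl
  | cons ω w ih => exact (congrArg (A.un ω) ih).trans (Obj.un_add h ω _ _)

theorem Obj.unWord_bin (h : C.Obj A) (w : List S.Unary) (s : S.Binary) (x y : A) :
    A.unWord w (A.bin s x y) = A.bin s (A.unWord w x) y := by
  induction w with
  | nil => rfl
  | cons ω w ih => exact (congrArg (A.un ω) ih).trans (Obj.un_bin h ω s _ _)

theorem unWord_append_singleton (A : OpAlg S) (w : List S.Unary) (ω : S.Unary) (x : A) :
    A.unWord (w ++ [ω]) x = A.unWord w (A.un ω x) := by
  simp [OpAlg.unWord]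

end Obj

/-! ### Fibre products and derived actions -/

/-- The fibre product of two homomorphisms `p` and `q`, as a subalgebra of the direct product. -/
def fiberProduct {E B X : OpAlg S} {p : E → X} {q : B → X} (hp : IsHom p) (hq : IsHom q) :
    OpAlg S where
  carrier := {x : E × B // p x.1 = q x.2}
  zero := ⟨(0, 0), by rw [hp.map_zero, hq.map_zero]⟩
  neg x := ⟨(-x.1.1, -x.1.2), by rw [hp.map_neg, hq.map_neg, x.2]⟩
  add x y := ⟨(x.1.1 + y.1.1, x.1.2 + y.1.2), by rw [hp.map_add, hq.map_add, x.2, y.2]⟩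
  un w x := ⟨(E.un w x.1.1, B.un w x.1.2), by rw [hp.map_un, hq.map_un, x.2]⟩
  bin s x y := ⟨(E.bin s x.1.1 y.1.1, B.bin s x.1.2 y.1.2), by
    rw [hp.map_bin, hq.map_bin, x.2, y.2]⟩

section fiberProduct

variable {E B X : OpAlg S} {p : E → X} {q : B → X} (hp : IsHom p) (hq : IsHom q)

theorem fiberProduct_isHom_fst : IsHom (fun x : fiberProduct hp hq => x.1.1) :=
  ⟨rfl, fun _ => rfl, fun _ _ => rfl, fun _ _ => rfl, fun _ _ _ => rfl⟩

theorem fiberProduct_isHom_snd : IsHom (fun x : fiberProduct hp hq => x.1.2) :=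
  ⟨rfl, fun _ => rfl, fun _ _ => rfl, fun _ _ => rfl, fun _ _ _ => rfl⟩

theorem obj_fiberProduct (hE : C.Obj E) (hB : C.Obj B) : C.Obj (fiberProduct hp hq) := by
  intro e he v
  refine Subtype.ext (Prod.ext ?_ ?_)
  · have h := fiberProduct_isHom_fst hp hq
    exact (h.eval v e.1).trans ((hE e he _).trans (h.eval v e.2).symm)
  · have h := fiberProduct_isHom_snd hp hq
    exact (h.eval v e.1).trans ((hB e he _).trans (h.eval v e.2).symm)

end fiberProduct

/-- The fibre product of the projection `p` of an extension of `B` by `A` with a homomorphism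
`q : D → B` is a split extension of `D` by `A`, provided that `q` lifts to `τ : D → E`. -/
theorem CategoryOfInterest.IsSplitExtension.fiberProduct {A B D E : OpAlg S} {i : A → E}
    {p : E → B} {σ : B → E} (hE : C.IsSplitExtension i p σ) {q : D → B} {τ : D → E}
    (hD : C.Obj D) (hq : IsHom q) (hτ : IsHom τ) (hpτ : ∀ x, p (τ x) = q x) :
    C.IsSplitExtension (E := CatInterest.fiberProduct hE.hom_p hq)
      (fun a => ⟨(i a, 0), ((hE.kernel _).2 ⟨a, rfl⟩).trans hq.map_zero.symm⟩)
      (fun x => x.1.2) (fun x => ⟨(τ x, x), hpτ x⟩) where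
  obj_left := hE.obj_left
  obj_mid := obj_fiberProduct _ _ hE.obj_mid hD
  obj_right := hD
  hom_i :=
    { map_zero := Subtype.ext (Prod.ext hE.hom_i.map_zero rfl)
      map_neg := fun _ => Subtype.ext (Prod.ext (hE.hom_i.map_neg _) (Obj.neg_zero hD).symm)
      map_add := fun _ _ =>
        Subtype.ext (Prod.ext (hE.hom_i.map_add _ _) (Obj.zero_add hD _).symm)
      map_un := fun w _ =>
        Subtype.ext (Prod.ext (hE.hom_i.map_un _ _) (map_un_zero hD w).symm)
      map_bin := fun s _ _ =>
        Subtype.ext (Prod.ext (hE.hom_i.map_bin _ _ _) (Obj.zero_bin hD s _).symm) }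
  hom_p := fiberProduct_isHom_snd _ _
  hom_σ :=
    { map_zero := Subtype.ext (Prod.ext hτ.map_zero rfl)
      map_neg := fun _ => Subtype.ext (Prod.ext (hτ.map_neg _) rfl)
      map_add := fun _ _ => Subtype.ext (Prod.ext (hτ.map_add _ _) rfl)
      map_un := fun _ _ => Subtype.ext (Prod.ext (hτ.map_un _ _) rfl)
      map_bin := fun _ _ _ => Subtype.ext (Prod.ext (hτ.map_bin _ _ _) rfl) }
  surjective x := ⟨⟨(τ x, x), hpτ x⟩, rfl⟩
  injective x y h := hE.injective (congrArg (fun z => z.1.1) h)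
  kernel := by
    rintro ⟨⟨e, x⟩, hex⟩
    constructor
    · rintro (rfl : x = 0)
      obtain ⟨a, rfl⟩ := (hE.kernel e).1 (hex.trans hq.map_zero)
      exact ⟨a, rfl⟩
    · rintro ⟨a, h⟩
      exact (congrArg (fun z => z.1.2) h).symm
  split _ := rfl

/-- If an object `D` is mapped to an extension `E` of `B` by `A`, then the actions of `D` on the
kernel `A` by conjugation and multiplication in `E` are derived actions. -/
theorem CategoryOfInterest.IsSplitExtension.isDerived {A B D E : OpAlg S} {i : A → E}
    {p : E → B} {σ : B → E} (hE : C.IsSplitExtension i p σ) {τ : D → E}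
    (hD : C.Obj D) (hτ : IsHom τ) {act : ActionSet D A}
    (hdot : ∀ x a, i (act.dot x a) = τ x + i a + -τ x)
    (hstar : ∀ s x a, i (act.star s x a) = E.bin s (τ x) (i a)) : C.IsDerived act := by
  refine ⟨_, _, _, _, hE.fiberProduct hD (hE.hom_p.comp hτ) hτ (fun _ => rfl), ?_, ?_⟩
  · intro x a
    refine Subtype.ext (Prod.ext (hdot x a) ?_)
    change (0 : D) = x + 0 + -x
    rw [Obj.add_zero hD, Obj.add_neg hD]
  · intro s x a
    exact Subtype.ext (Prod.ext (hstar s x a) (Obj.bin_zero hD s x).symm)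

theorem IsDerived.comap {A B D : OpAlg S} {act : ActionSet B A} (h : C.IsDerived act)
    (hD : C.Obj D) {q : D → B} (hq : IsHom q) :
    C.IsDerived (⟨fun x => act.dot (q x), fun s x => act.star s (q x)⟩ : ActionSet D A) := by
  obtain ⟨E, i, p, σ, hE, hd, hs⟩ := h
  exact hE.isDerived hD (hE.hom_σ.comp hq) (fun x a => hd (q x) a) (fun s x a => hs s (q x) a)

theorem CategoryOfInterest.IsSplitExtension.exists_dot {A B E : OpAlg S} {i : A → E} {p : E → B}
    {σ : B → E} (hE : C.IsSplitExtension i p σ) (e : E) (a : A) : ∃ a', i a' = e + i a + -e := by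
  rw [← hE.kernel, hE.hom_p.map_add, hE.hom_p.map_add, (hE.kernel (i a)).2 ⟨a, rfl⟩,
    hE.hom_p.map_neg, Obj.add_zero hE.obj_right, Obj.add_neg hE.obj_right]

theorem CategoryOfInterest.IsSplitExtension.exists_star {A B E : OpAlg S} {i : A → E} {p : E → B}
    {σ : B → E} (hE : C.IsSplitExtension i p σ) (s : S.Binary) (e : E) (a : A) :
    ∃ a', i a' = E.bin s e (i a) := by
  rw [← hE.kernel, hE.hom_p.map_bin, (hE.kernel (i a)).2 ⟨a, rfl⟩, Obj.bin_zero hE.obj_right]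

/-- The action of a split extension on its kernel, by conjugation and multiplication. The values
are chosen as preimages under `i`, which are unique since `i` is injective. -/
noncomputable def kernelAct {A B E : OpAlg S} {i : A → E} {p : E → B} {σ : B → E}
    (hE : C.IsSplitExtension i p σ) : ActionSet E A where
  dot e a := (hE.exists_dot e a).choose
  star s e a := (hE.exists_star s e a).choose

section kernelAct

variable {A B E : OpAlg S} {i : A → E} {p : E → B} {σ : B → E} (hE : C.IsSplitExtension i p σ)

theorem kernelAct_dot (e : E) (a : A) : i ((kernelAct hE).dot e a) = e + i a + -e :=
  (hE.exists_dot e a).choose_spec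

theorem kernelAct_star (s : S.Binary) (e : E) (a : A) :
    i ((kernelAct hE).star s e a) = E.bin s e (i a) :=
  (hE.exists_star s e a).choose_spec

theorem isDerived_kernelAct : C.IsDerived (kernelAct hE) :=
  hE.isDerived (τ := fun e => e) hE.obj_mid
    ⟨rfl, fun _ => rfl, fun _ _ => rfl, fun _ _ => rfl, fun _ _ _ => rfl⟩
    (kernelAct_dot hE) (kernelAct_star hE)

end kernelAct

/-! ### Semidirect products -/

theorem IsDerived.obj_acting {A B : OpAlg S} {act : ActionSet B A} (h : C.IsDerived act) :
    C.Obj B := by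
  obtain ⟨E, i, p, σ, hE, -⟩ := h
  exact hE.obj_right

/-- The semidirect product of a derived action is embedded in a split extension which yields the
action, by `(b, a) ↦ i(a) + σ(b)`. -/
theorem IsDerived.obj_semidirect {A B : OpAlg S} {act : ActionSet B A} (h : C.IsDerived act) :
    C.Obj (semidirect act) := by
  obtain ⟨E, i, p, σ, hE, hd, hs⟩ := h
  have hO := hE.obj_mid
  let _ := Obj.addGroup hO
  have hp (b : B) (a : A) : p (i a + σ b) = b := by
    rw [hE.hom_p.map_add, (hE.kernel _).2 ⟨a, rfl⟩, hE.split, Obj.zero_add hE.obj_right]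
  refine obj_of_injective (f := fun x : semidirect act => i x.2 + σ x.1) (B := E) ?_ ?_ hO
  · refine ⟨?_, ?_, ?_, ?_, ?_⟩
    · change i 0 + σ 0 = 0
      rw [hE.hom_i.map_zero, hE.hom_σ.map_zero, Obj.add_zero hO]
    · intro x
      change i (act.dot (-x.1) (-x.2)) + σ (-x.1) = -(i x.2 + σ x.1)
      rw [hd, hE.hom_σ.map_neg, hE.hom_i.map_neg]
      simp
    · intro x y
      change i (x.2 + act.dot x.1 y.2) + σ (x.1 + y.1) = i x.2 + σ x.1 + (i y.2 + σ y.1)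
      rw [hE.hom_i.map_add, hd, hE.hom_σ.map_add]
      simp [_root_.add_assoc]
    · intro w x
      change i (A.un w x.2) + σ (B.un w x.1) = E.un w (i x.2 + σ x.1)
      rw [hE.hom_i.map_un, hE.hom_σ.map_un, Obj.un_add hO]
    · intro s x y
      change i (A.bin s x.2 y.2 + act.star (S.opp s) y.1 x.2 + act.star s x.1 y.2) +
        σ (B.bin s x.1 y.1) = E.bin s (i x.2 + σ x.1) (i y.2 + σ y.1)
      rw [hE.hom_i.map_add, hE.hom_i.map_add, hE.hom_i.map_bin, hs, hs, hE.hom_σ.map_bin,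
        Obj.opp_bin hO, Obj.add_bin hO, Obj.bin_add hO, Obj.bin_add hO]
      simp only [Obj.add_assoc hO]
  · rintro ⟨b, a⟩ ⟨b', a'⟩ (hx : i a + σ b = i a' + σ b')
    have hb : b = b' := by rw [← hp b a, hx, hp]
    subst hb
    exact Prod.ext rfl (hE.injective (add_right_cancel hx))

/-- If the semidirect product `B ⋉ A` is an object, then it is a split extension of `B` by `A`
which yields the given action. -/
theorem isDerived_of_obj_semidirect {A B : OpAlg S} {act : ActionSet B A} (hA : C.Obj A)
    (h : C.Obj (semidirect act)) (hstar : ∀ s a, act.star s 0 a = 0) : C.IsDerived act := by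
  have hp : IsHom (fun x : semidirect act => x.1) :=
    ⟨rfl, fun _ => rfl, fun _ _ => rfl, fun _ _ => rfl, fun _ _ _ => rfl⟩
  have hB : C.Obj B := obj_of_surjective hp (fun b => ⟨((b, 0) : B × A), rfl⟩) h
  -- The identities `0 + x = x`, `x + 0 = x`, `x * 0 = 0` of the semidirect product.
  have h0 (a : A) : act.dot 0 a = a := by
    have := congrArg Prod.snd (Obj.zero_add h ((0, a) : B × A))
    change 0 + act.dot 0 a = a at this
    rwa [Obj.zero_add hA] at this
  have hdot (b : B) : act.dot b 0 = 0 := by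
    have := congrArg Prod.snd (Obj.add_zero h ((b, 0) : B × A))
    change 0 + act.dot b 0 = 0 at this
    rwa [Obj.zero_add hA] at this
  have hstar' (s : S.Binary) (b : B) : act.star s b 0 = 0 := by
    have := congrArg Prod.snd (Obj.bin_zero h s ((b, 0) : B × A))
    change A.bin s 0 0 + act.star (S.opp s) 0 0 + act.star s b 0 = 0 at this
    rwa [hstar, Obj.bin_zero hA, Obj.zero_add hA, Obj.zero_add hA] at this
  refine ⟨semidirect act, fun a => ((0, a) : B × A), fun x => x.1, fun b => ((b, 0) : B × A),
    ⟨hA, h, hB, ⟨rfl, ?_, ?_, ?_, ?_⟩, hp, ⟨rfl, ?_, ?_, ?_, ?_⟩,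
    fun b => ⟨((b, 0) : B × A), rfl⟩, fun x y hxy => congrArg Prod.snd hxy, ?_, fun _ => rfl⟩,
    ?_, ?_⟩
  · intro a
    refine Prod.ext (Obj.neg_zero hB).symm ?_
    change -a = act.dot (-0) (-a)
    rw [Obj.neg_zero hB, h0]
  · intro a a'
    refine Prod.ext (Obj.zero_add hB _).symm ?_
    change a + a' = a + act.dot 0 a'
    rw [h0]
  · exact fun w a => Prod.ext (map_un_zero hB w).symm rfl
  · intro s a a'
    refine Prod.ext (Obj.zero_bin hB s _).symm ?_
    change A.bin s a a' = A.bin s a a' + act.star (S.opp s) 0 a + act.star s 0 a'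
    rw [hstar, hstar, Obj.add_zero hA, Obj.add_zero hA]
  · intro b
    refine Prod.ext rfl ?_
    change 0 = act.dot (-b) (-0)
    rw [Obj.neg_zero hA, hdot]
  · intro b b'
    refine Prod.ext rfl ?_
    change 0 = 0 + act.dot b 0
    rw [hdot, Obj.zero_add hA]
  · exact fun w b => Prod.ext rfl (map_un_zero hA w).symm
  · intro s b b'
    refine Prod.ext rfl ?_
    change 0 = A.bin s 0 0 + act.star (S.opp s) b' 0 + act.star s b 0
    rw [hstar', hstar', Obj.bin_zero hA, Obj.zero_add hA, Obj.zero_add hA]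
  · rintro ⟨b, a⟩
    constructor
    · rintro (rfl : b = 0)
      exact ⟨a, rfl⟩
    · rintro ⟨a', ha⟩
      exact (congrArg Prod.fst ha).symm
  · intro b a
    refine Prod.ext ?_ ?_
    · change 0 = b + 0 + -b
      rw [Obj.add_zero hB, Obj.add_neg hB]
    · change act.dot b a = 0 + act.dot b a + act.dot (b + 0) (act.dot (-b) (-0))
      rw [Obj.neg_zero hA, hdot, hdot, Obj.zero_add hA, Obj.add_zero hA]
  · intro s b a
    refine Prod.ext (Obj.bin_zero hB s b).symm ?_
    change act.star s b a = A.bin s 0 a + act.star (S.opp s) 0 0 + act.star s b a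
    rw [hstar, Obj.zero_bin hA, Obj.zero_add hA, Obj.zero_add hA]

/-! ### The operator families of a derived action -/

theorem operatorFamilies_ext {A : OpAlg S} {f g : operatorFamilies C A}
    (hdot : ∀ w a, (f w).dot a = (g w).dot a)
    (hstar : ∀ w s a, (f w).star s a = (g w).star s a) : f = g :=
  funext fun w => Operator.ext (Equiv.ext (hdot w)) (funext fun s => funext fun a => hstar w s a)

/-- The operations of operator families are given by the formulas which hold for derived actions;
for the products `b * b'` these are the two axioms of a category of interest, applied to the split
extension. -/
theorem isHom_bold {A B : OpAlg S} {act : ActionSet B A} (h : C.IsDerived act) :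
    IsHom (bold h) := by
  have hB := IsDerived.obj_acting h
  obtain ⟨E, i, p, σ, hE, hd, hs⟩ := id h
  have hO := hE.obj_mid
  let _ := Obj.addGroup hO
  refine ⟨operatorFamilies_ext ?_ ?_, fun b => operatorFamilies_ext ?_ ?_,
    fun b b' => operatorFamilies_ext ?_ ?_, fun ω b => operatorFamilies_ext ?_ ?_,
    fun t b b' => operatorFamilies_ext ?_ ?_⟩
  · intro w a
    change act.dot (B.unWord w 0) a = a
    apply hE.injective
    rw [Obj.unWord_zero hB, hd, hE.hom_σ.map_zero, Obj.neg_zero hO, Obj.zero_add hO,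
      Obj.add_zero hO]
  · intro w s a
    change act.star s (B.unWord w 0) a = 0
    apply hE.injective
    rw [Obj.unWord_zero hB, hs, hE.hom_σ.map_zero, Obj.zero_bin hO, hE.hom_i.map_zero]
  · intro w a
    change act.dot (B.unWord w (-b)) a = act.dot (-B.unWord w b) a
    rw [Obj.unWord_neg hB]
  · intro w s a
    change act.star s (B.unWord w (-b)) a = -act.star s (B.unWord w b) a
    apply hE.injective
    rw [Obj.unWord_neg hB, hE.hom_i.map_neg, hs, hs, hE.hom_σ.map_neg, Obj.neg_bin hO]
  · intro w a
    change act.dot (B.unWord w (b + b')) a = act.dot (B.unWord w b) (act.dot (B.unWord w b') a)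
    apply hE.injective
    rw [Obj.unWord_add hB, hd, hd, hd, hE.hom_σ.map_add]
    simp [_root_.add_assoc]
  · intro w s a
    change act.star s (B.unWord w (b + b')) a =
      act.star s (B.unWord w b) a + act.star s (B.unWord w b') a
    apply hE.injective
    rw [Obj.unWord_add hB, hE.hom_i.map_add, hs, hs, hs, hE.hom_σ.map_add, Obj.add_bin hO]
  · intro w a
    change act.dot (B.unWord w (B.un ω b)) a = act.dot (B.unWord (w ++ [ω]) b) a
    rw [unWord_append_singleton]
  · intro w s a
    change act.star s (B.unWord w (B.un ω b)) a = act.star s (B.unWord (w ++ [ω]) b) a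
    rw [unWord_append_singleton]
  · intro w a
    change act.dot (B.unWord w (B.bin t b b')) a = a
    apply hE.injective
    rw [Obj.unWord_bin hB, hd, hE.hom_σ.map_bin, ← C.axiom1 E hO, Obj.add_assoc hO,
      Obj.add_neg hO, Obj.add_zero hO]
  · intro w s a
    change act.star s (B.unWord w (B.bin t b b')) a =
      (C.word t s).eval A (TripleArg.evalOp (bold h b w) (bold h b' []) a)
    apply hE.injective
    rw [Obj.unWord_bin hB, hs, hE.hom_σ.map_bin, C.axiom2 E hO, hE.hom_i.eval]
    congr 1
    funext x
    cases x <;>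
      simp only [TripleArg.eval, TripleArg.evalOp, bold, hs, OpAlg.unWord, List.foldr_nil,
        Obj.opp_bin hO]

/-- The homomorphism `b ↦ 𝐛` from an object which acts on `A` to `𝔅(A)`. -/
def toFrakB {A B : OpAlg S} {act : ActionSet B A} (h : C.IsDerived act) (b : B) : frakB C A :=
  ⟨bold h b, .bold h b⟩

theorem isHom_toFrakB {A B : OpAlg S} {act : ActionSet B A} (h : C.IsDerived act) :
    IsHom (toFrakB h) where
  map_zero := Subtype.ext (isHom_bold h).map_zero
  map_neg _ := Subtype.ext ((isHom_bold h).map_neg _)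
  map_add _ _ := Subtype.ext ((isHom_bold h).map_add _ _)
  map_un _ _ := Subtype.ext ((isHom_bold h).map_un _ _)
  map_bin _ _ _ := Subtype.ext ((isHom_bold h).map_bin _ _ _)

/-- The member of `f ∈ 𝔅(A)` with index `w` is the member of `w(f)` with empty index. -/
theorem frakB_unWord {A : OpAlg S} (w v : List S.Unary) (f : frakB C A) :
    ((frakB C A).unWord w f).1 v = f.1 (v ++ w) := by
  induction w generalizing v with
  | nil => simp [OpAlg.unWord]
  | cons ω w ih =>
    change ((frakB C A).unWord w f).1 (v ++ [ω]) = _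
    rw [ih, List.append_assoc, List.singleton_append]

/-- A homomorphism to `𝔅(A)` which induces an action of `B` on `A` sends `b` to `𝐛`: this is the
uniqueness in the universal property of an actor. -/
theorem IsHom.eq_toFrakB {A B : OpAlg S} {act : ActionSet B A} (h : C.IsDerived act)
    {φ : B → frakB C A} (hφ : IsHom φ) (hd : ∀ b a, act.dot b a = (frakBAct C A).dot (φ b) a)
    (hs : ∀ s b a, act.star s b a = (frakBAct C A).star s (φ b) a) (b : B) :
    φ b = toFrakB h b := by
  have key (w : List S.Unary) : (φ b).1 w = (φ (B.unWord w b)).1 [] := by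
    rw [hφ.unWord, frakB_unWord, List.nil_append]
  refine Subtype.ext (operatorFamilies_ext (fun w a => ?_) (fun w s a => ?_))
  · rw [key]
    exact (hd (B.unWord w b) a).symm
  · rw [key]
    exact (hs s (B.unWord w b) a).symm

/-- Equivariant homomorphisms preserve the attached operator families. -/
theorem toFrakB_comp {A B D : OpAlg S} {act : ActionSet B A} {actD : ActionSet D A}
    (h : C.IsDerived act) (hD : C.IsDerived actD) {φ : D → B} (hφ : IsHom φ)
    (hd : ∀ x a, actD.dot x a = act.dot (φ x) a)
    (hs : ∀ s x a, actD.star s x a = act.star s (φ x) a) (x : D) :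
    toFrakB h (φ x) = toFrakB hD x :=
  ((isHom_toFrakB h).comp hφ).eq_toFrakB hD hd hs x

/-! ### From an actor to the semidirect product -/

section Actor

variable {A X : OpAlg S} {act : ActionSet X A} {del : A → X}

/-- The families `𝐱`, for `x` in an actor `X`, contain all families `𝐛` since the action of `B` is
induced from that of `X`, and they are closed under the operations. -/
theorem toFrakB_surjective_of_isActor (h : C.IsActor act del) :
    Function.Surjective (toFrakB h.crossed.derived) := by
  have hb := isHom_bold h.crossed.derived
  rintro ⟨f, hf⟩
  suffices ∃ x, bold h.crossed.derived x = f from this.imp fun x hx => Subtype.ext hx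
  induction hf with
  | @bold B actB hB b =>
    obtain ⟨φ, ⟨hφ, hd, hs⟩, -⟩ := h.universal B actB (IsDerived.obj_acting hB) hB
    exact ⟨φ b, congrArg Subtype.val (toFrakB_comp h.crossed.derived hB hφ hd hs b)⟩
  | zero => exact ⟨0, hb.map_zero⟩
  | neg _ ih =>
    obtain ⟨x, rfl⟩ := ih
    exact ⟨-x, hb.map_neg x⟩
  | add _ _ ih ih' =>
    obtain ⟨x, rfl⟩ := ih
    obtain ⟨y, rfl⟩ := ih'
    exact ⟨x + y, hb.map_add x y⟩
  | un ω _ ih =>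
    obtain ⟨x, rfl⟩ := ih
    exact ⟨X.un ω x, hb.map_un ω x⟩
  | bin s _ _ ih ih' =>
    obtain ⟨x, rfl⟩ := ih
    obtain ⟨y, rfl⟩ := ih'
    exact ⟨X.bin s x y, hb.map_bin s x y⟩

/-- Both projections of the kernel pair of `x ↦ 𝐱` induce the same action of the kernel pair on
`A`, so that they are equal by the uniqueness in the universal property of the actor. -/
theorem toFrakB_injective_of_isActor (h : C.IsActor act del) :
    Function.Injective (toFrakB h.crossed.derived) := by
  have hX := h.crossed.derived
  have hb := isHom_toFrakB hX
  have hK := obj_fiberProduct hb hb h.crossed.obj_target h.crossed.obj_target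
  have hfst := fiberProduct_isHom_fst hb hb
  have hder := IsDerived.comap hX hK hfst
  intro x y hxy
  have key := (h.universal _ _ hK hder).unique
    (y₁ := fun z => z.1.1) (y₂ := fun z => z.1.2)
    ⟨hfst, fun _ _ => rfl, fun _ _ _ => rfl⟩
    ⟨fiberProduct_isHom_snd hb hb,
      fun z a => congrArg (fun f => (frakBAct C A).dot f a) z.2,
      fun s z a => congrArg (fun f => (frakBAct C A).star s f a) z.2⟩
  exact congrFun key ⟨(x, y), hxy⟩

theorem obj_semidirect_of_isActor (h : C.IsActor act del) :
    C.Obj (semidirect (frakBAct C A)) := by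
  have hb := isHom_toFrakB h.crossed.derived
  refine obj_of_surjective
    (f := fun x : semidirect act => ((toFrakB h.crossed.derived x.1, x.2) : frakB C A × A))
    (B := semidirect (frakBAct C A)) ?_ ?_ (IsDerived.obj_semidirect h.crossed.derived)
  · exact ⟨Prod.ext hb.map_zero rfl,
      fun x => Prod.ext (hb.map_neg x.1)
        (congrArg (fun f => (frakBAct C A).dot f (-x.2)) (hb.map_neg x.1)),
      fun x y => Prod.ext (hb.map_add x.1 y.1) rfl,
      fun w x => Prod.ext (hb.map_un w x.1) rfl,
      fun s x y => Prod.ext (hb.map_bin s x.1 y.1) rfl⟩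
  · rintro ⟨f, a⟩
    obtain ⟨x, rfl⟩ := toFrakB_surjective_of_isActor h f
    exact ⟨((x, a) : X × A), rfl⟩

theorem toFrakB_del (hA : C.Obj A) (h : C.IsCrossedModule act del) (a : A) :
    toFrakB h.derived (del a) = dMap hA a :=
  toFrakB_comp h.derived (isDerived_conj hA) h.hom
    (fun a a' => (h.dot_del a a').symm) (fun s a a' => (h.star_del s a a').symm) a

end Actor

/-! ### From the semidirect product to an actor -/

/-- Suppose that the action of `𝔅(A)` on `A` comes from a split extension `E`. The homomorphism
`E → 𝔅(A)` given by the action of `E` on its kernel `A` is `d` on `A` and the identity on `𝔅(A)`;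
so it maps the formulas for the action of `𝔅(A)` on `A`, which hold in `E`, to the equations of a
crossed module. -/
theorem isCrossedModule_dMap {A : OpAlg S} (hA : C.Obj A) (hF : C.IsDerived (frakBAct C A)) :
    C.IsCrossedModule (frakBAct C A) (dMap hA) := by
  obtain ⟨E, i, p, σ, hE, hd, hs⟩ := id hF
  have hk := isDerived_kernelAct hE
  have hθ := isHom_toFrakB hk
  have hi (a : A) : toFrakB hk (i a) = dMap hA a := by
    refine toFrakB_comp hk (isDerived_conj hA) hE.hom_i (fun a a' => ?_) (fun s a a' => ?_) a
    · apply hE.injective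
      rw [kernelAct_dot hE, ← hE.hom_i.map_neg, ← hE.hom_i.map_add, ← hE.hom_i.map_add]
      rfl
    · apply hE.injective
      rw [kernelAct_star hE, ← hE.hom_i.map_bin]
      rfl
  have hσ (f : frakB C A) : toFrakB hk (σ f) = f := by
    refine (toFrakB_comp hk hF hE.hom_σ
      (fun f a => hE.injective ((hd f a).trans (kernelAct_dot hE (σ f) a).symm))
      (fun s f a => hE.injective ((hs s f a).trans (kernelAct_star hE s (σ f) a).symm)) f).trans ?_
    exact (IsHom.eq_toFrakB hF (φ := fun f => f)
      ⟨rfl, fun _ => rfl, fun _ _ => rfl, fun _ _ => rfl, fun _ _ _ => rfl⟩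
      (fun _ _ => rfl) (fun _ _ _ => rfl) f).symm
  refine ⟨hA, hE.obj_right, hF, isHom_toFrakB (isDerived_conj hA), ?_, fun _ _ => rfl,
    fun _ _ _ => rfl, ?_, ?_⟩
  · intro f a
    rw [← hi, hd, hθ.map_add, hθ.map_add, hθ.map_neg, hi, hσ]
  · intro s f a
    rw [← hi, hs, hθ.map_bin, hi, hσ]
  · intro s a f
    rw [← hi, hs, Obj.opp_bin hE.obj_mid, hθ.map_bin, hi, hσ]

theorem isActor_dMap {A : OpAlg S} (hA : C.Obj A) (h : C.Obj (semidirect (frakBAct C A))) :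
    C.IsActor (frakBAct C A) (dMap hA) where
  crossed := isCrossedModule_dMap hA (isDerived_of_obj_semidirect hA h fun _ _ => rfl)
  universal _ _ _ hder :=
    ⟨toFrakB hder, ⟨isHom_toFrakB hder, fun _ _ => rfl, fun _ _ _ => rfl⟩,
      fun _ hφ => funext (hφ.1.eq_toFrakB hder hφ.2.1 hφ.2.2)⟩

end CatInterest

open CatInterest in
theorem theorem3p6 {S : Signature.{u}} (C : CategoryOfInterest S) (A : OpAlg S) (hA : C.Obj A) :
    (C.HasActor A ↔ C.Obj (semidirect (frakBAct C A))) ∧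
    (C.HasActor A →
      C.IsActor (frakBAct C A) (dMap hA) ∧
      ∀ (X : OpAlg S) (act : ActionSet X A) (del : A → X), C.IsActor act del →
        ∃ e : X → frakB C A, IsHom e ∧ Function.Bijective e ∧ (∀ a, e (del a) = dMap hA a) ∧
          (∀ x a, (frakBAct C A).dot (e x) a = act.dot x a) ∧
          (∀ s x a, (frakBAct C A).star s (e x) a = act.star s x a)) := by
  have hobj : C.HasActor A → C.Obj (semidirect (frakBAct C A)) :=
    fun ⟨_, _, _, h⟩ => obj_semidirect_of_isActor h
  refine ⟨⟨hobj, fun h => ⟨_, _, _, isActor_dMap hA h⟩⟩, fun hact =>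
    ⟨isActor_dMap hA (hobj hact), fun X act del h => ?_⟩⟩
  exact ⟨toFrakB h.crossed.derived, isHom_toFrakB _,
    ⟨toFrakB_injective_of_isActor h, toFrakB_surjective_of_isActor h⟩, toFrakB_del hA h.crossed,
    fun _ _ => rfl, fun _ _ _ => rfl⟩
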